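/- Let $X$ and $F$ be nonempty sets and let $\ell : X \times F \to [0,1]$. For $\alpha > 0$, the $\alpha$-sequential fat-shattering dimension $\mathrm{sfat}_\alpha(G)$ of a class $G \subseteq [0,1]^X$ is the largest $d$ for which there are a complete binary tree $\mathbf x = (\mathbf x_1, \dots, \mathbf x_d)$ of depth $d$ with labels $\mathbf x_t(k_1,\dots,k_{t-1}) \in X$ and a complete binary tree $\mathbf s = (\mathbf s_1,\dots,\mathbf s_d)$ of depth $d$ with labels $\mathbf s_t(k_1,\dots,k_{t-1}) \in [0,1]$ such that for every $k \in \{-1,1\}^d$ some $g \in G$ satisfies $$k_t \cdot \bigl( g(\mathbf x_t(k_1,\dots,k_{t-1})) - \mathbf s_t(k_1,\dots,k_{t-1}) \bigr) \ge \alpha/2 \quad \text{for all } 1 \le t \le d;$$ it is $0$ if there is no such $d \geq 1$, and $\infty$ if there is no largest one. Suppose that $(X, F, \ell)$ is a sequential Glivenko-Cantelli (SGC) game, that is, that the loss class $F^\ell = \{ x \mapsto \ell(x,f) : f \in F \}$ satisfies $\mathrm{sfat}_\alpha(F^\ell) < \infty$ for every $\alpha > 0$. Then the following hold. 1. For any $\sigma$-algebras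 on $X$ and $F$ for which the expectations below are defined (that is, for all probability measures $P_X$ on $X$ and $P_F$ on $F$, $\ell$ is measurable with respect to the completion of $P_X \times P_F$; for example, $\ell$ is measurable for the product $\sigma$-algebra), with $\Delta(X)$, $\Delta(F)$ denoting the sets of all probability measures on $X$, $F$, $$\inf_{P_X \in \Delta(X)} \sup_{P_F \in \Delta(F)} \mathbb E_{(x,f) \sim P_X \times P_F}[\ell(x,f)] = \sup_{P_F \in \Delta(F)} \inf_{P_X \in \Delta(X)} \mathbb E_{(x,f) \sim P_X \times P_F}[\ell(x,f)].$$ 2. The same equality holds when $P_X$ and $P_F$ range over the sets $\Delta^\circ(X)$ and $\Delta^\circ(F)$ of finite-support probability distributions on $X$ and $F$, respectively (here no $\sigma$-algebra or measurability assumption is needed). -/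

import Mathlib

open MeasureTheory

/-- A complete `Z`-valued binary tree of depth `d`.  Level `t` (for `t = 0, …, d - 1`) has one node
for each sign sequence `(ε₀, …, ε_{t-1}) ∈ {-1, 1}^t`, and each node is labelled by an element
of `Z`.  The sign set `{-1, 1}` is `ℤˣ`. -/
abbrev BinTree (Z : Type*) (d : ℕ) : Type _ :=
  (t : Fin d) → (Fin (t : ℕ) → ℤˣ) → Z

/-- The label of the node at level `t` on the root-to-leaf path `k ∈ {-1, 1}^d`. -/
def BinTree.label {Z : Type*} {d : ℕ} (z : BinTree Z d) (k : Fin d → ℤˣ) (t : Fin d) : Z :=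
  z t (fun i => k (Fin.castLE t.isLt.le i))

/-- The class `G ⊆ [0,1]^X` `α`-shatters the tree `x`, as witnessed by the `[0,1]`-valued
tree `s`. -/
def Shatters {X : Type*} (G : Set (X → unitInterval)) (α : ℝ) {d : ℕ}
    (x : BinTree X d) (s : BinTree unitInterval d) : Prop :=
  ∀ k : Fin d → ℤˣ, ∃ g ∈ G, ∀ t : Fin d,
    α / 2 ≤ (((k t : ℤˣ) : ℤ) : ℝ) * ((g (x.label k t) : ℝ) - (s.label k t : ℝ))

/-- The `α`-sequential fat-shattering dimension of `G ⊆ [0,1]^X`: the largest depth of a tree that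
is `α`-shattered by `G` (`0` if no tree of positive depth is, `⊤` if there is no largest depth). -/
noncomputable def sfat {X : Type*} (α : ℝ) (G : Set (X → unitInterval)) : ℕ∞ :=
  ⨆ (d : ℕ) (_ : ∃ (x : BinTree X d) (s : BinTree unitInterval d), Shatters G α x s), (d : ℕ∞)

/-- The loss class `{x ↦ ℓ(x, f) : f ∈ F}` of the game `(X, F, ℓ)`. -/
def lossClass {X F : Type*} (ℓ : X → F → unitInterval) : Set (X → unitInterval) :=
  Set.range (fun (f : F) (x : X) => ℓ x f)

/-- The game `(X, F, ℓ)` is a sequential Glivenko-Cantelli game (it is online learnable): its loss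
class has finite sequential fat-shattering dimension at every scale. -/
def IsSGCGame {X F : Type*} (ℓ : X → F → unitInterval) : Prop :=
  ∀ α : ℝ, 0 < α → sfat α (lossClass ℓ) < ⊤

/-- The expected loss `E_{(x,f) ∼ P × Q} ℓ(x, f)` for probability measures `P` on `X` and
`Q` on `F`. -/
noncomputable def expLoss {X F : Type*} [MeasurableSpace X] [MeasurableSpace F]
    (ℓ : X → F → unitInterval) (P : ProbabilityMeasure X) (Q : ProbabilityMeasure F) : ℝ :=
  ∫ z, (ℓ z.1 z.2 : ℝ) ∂((P : Measure X).prod (Q : Measure F))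

/-- The expectations of `ℓ` under all pairs of mixed strategies make sense: `ℓ` is measurable with
respect to the completion of every product `P × Q` of probability measures.  This holds
in particular whenever `ℓ` is measurable for the product σ-algebra. -/
def HasExpLoss {X F : Type*} [MeasurableSpace X] [MeasurableSpace F]
    (ℓ : X → F → unitInterval) : Prop :=
  ∀ (P : ProbabilityMeasure X) (Q : ProbabilityMeasure F),
    AEMeasurable (fun z : X × F => (ℓ z.1 z.2 : ℝ)) ((P : Measure X).prod (Q : Measure F))

/-- The set of finite-support probability distributions on `S`. -/
abbrev FinDist (S : Type*) : Type _ := Convexity.StdSimplex ℝ S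

/-- The expected loss `E_{(x,f) ∼ p × q} ℓ(x, f) = ∑_x ∑_f p(x) q(f) ℓ(x, f)` for finite-support
distributions `p` on `X` and `q` on `F`; no σ-algebra is involved. -/
noncomputable def finExpLoss {X F : Type*} (ℓ : X → F → unitInterval)
    (p : FinDist X) (q : FinDist F) : ℝ :=
  p.weights.sum (fun x a => q.weights.sum (fun f b => a * b * (ℓ x f : ℝ)))

/-! Suppose there is a gap: every finite-support `q` has a pure reply `x` of loss at most `a`, while
every finite-support `p` has a pure reply `f` of loss more than `b > a`. The finite minimax theorem
`exists_finDist_forall_lt` then gives, for any finite set of points, one `q` with loss above `b` on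
all of them.

Alternating the two facts, `LeafTree.exists_le_mean` builds trees of every depth `n`, with a
strategy `f` chosen at each leaf, along which the signed sum `∑ εₜ r(xₜ, f)` has mean at least `n *
(b - a) / 2` over the random signs: a failure of the sequential uniform law of large numbers.

Finite shattering dimension forbids this linear growth. `LeafTree.expMean_indicator_le` bounds the
exponential moment of the signed sum by a Gaussian and discretization factor times a polynomial in
`n`, and Jensen's inequality (`LeafTree.exp_mean_le`) compares it with the exponential of the mean.
At a suitable scale an exponential in `n` would be dominated by a polynomial, so `IsSGCGame.no_gap`
holds.

For general probability measures, a gap yields a gap for finite-support strategies, since these are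
themselves measures and some pure reply to them is as good as any mixed one. -/

/-- The expectation of `h` under a finite-support distribution `q`. -/
noncomputable def finExpect {S : Type*} (q : FinDist S) (h : S → ℝ) : ℝ :=
  q.weights.sum fun s b => b * h s

/-! ### Finite-support expectations and the finite minimax theorem -/

section finExpect

variable {S : Type*}

lemma finExpect_add (q : FinDist S) (g h : S → ℝ) :
    finExpect q (fun s => g s + h s) = finExpect q g + finExpect q h := by
  simp only [finExpect, mul_add, Finsupp.sum_add]

lemma finExpect_sub (q : FinDist S) (g h : S → ℝ) :
    finExpect q (fun s => g s - h s) = finExpect q g - finExpect q h := by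
  simp only [finExpect, mul_sub, Finsupp.sum_sub]

lemma finExpect_const (q : FinDist S) (c : ℝ) : finExpect q (fun _ => c) = c := by
  rw [finExpect, ← Finsupp.sum_mul, q.total, one_mul]

lemma finExpect_mono (q : FinDist S) {g h : S → ℝ} (H : ∀ s, g s ≤ h s) :
    finExpect q g ≤ finExpect q h :=
  Finset.sum_le_sum fun s _ => mul_le_mul_of_nonneg_left (H s) (q.nonneg s)

lemma exists_finExpect_le (q : FinDist S) (h : S → ℝ) : ∃ s, finExpect q h ≤ h s := by
  have hne := q.support_weights_nonempty
  obtain ⟨s, -, hs⟩ := q.weights.support.exists_max_image h hne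
  refine ⟨s, ?_⟩
  rw [← finExpect_const q (h s)]
  exact Finset.sum_le_sum fun t ht => mul_le_mul_of_nonneg_left (hs t ht) (q.nonneg t)

lemma exists_le_finExpect (q : FinDist S) (h : S → ℝ) : ∃ s, h s ≤ finExpect q h := by
  obtain ⟨s, hs⟩ := exists_finExpect_le q (fun s => 0 - h s)
  rw [finExpect_sub, finExpect_const] at hs
  exact ⟨s, by linarith⟩

lemma finExpect_single (s : S) (h : S → ℝ) :
    finExpect (Convexity.StdSimplex.single s) h = h s := by
  simp [finExpect]

lemma finExpect_convexCombPair (q q' : FinDist S) (h : S → ℝ) {a b : ℝ} (ha : 0 ≤ a) (hb : 0 ≤ b)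
    (hab : a + b = 1) :
    finExpect (Convexity.convexCombPair a b ha hb hab q q') h =
      a * finExpect q h + b * finExpect q' h := by
  classical
  simp only [finExpect, Convexity.StdSimplex.weights_convexCombPair]
  rw [Finsupp.sum_add_index (by simp) (by intros; ring), Finsupp.sum_smul_index (by simp),
    Finsupp.sum_smul_index (by simp), Finsupp.mul_sum, Finsupp.mul_sum]
  simp only [mul_assoc]

lemma finExpLoss_eq {X F : Type*} (ℓ : X → F → unitInterval) (p : FinDist X) (q : FinDist F) :
    finExpLoss ℓ p q = finExpect p fun x => finExpect q fun f => (ℓ x f : ℝ) := by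
  simp only [finExpLoss, finExpect, Finsupp.mul_sum, mul_assoc]

lemma finExpLoss_eq' {X F : Type*} (ℓ : X → F → unitInterval) (p : FinDist X) (q : FinDist F) :
    finExpLoss ℓ p q = finExpect q fun f => finExpect p fun x => (ℓ x f : ℝ) := by
  simp only [finExpLoss, finExpect, Finsupp.mul_sum]
  rw [Finsupp.sum_comm]
  simp only [mul_assoc, mul_left_comm]

/-- One half of von Neumann's minimax theorem, when one player is confined to finitely many pure
strategies. -/
theorem exists_finDist_forall_lt {X F : Type*} [Nonempty F] (r : X → F → ℝ) (b : ℝ)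
    (hb : ∀ p : FinDist X, ∃ f, b < finExpect p fun x => r x f) (A : Finset X) :
    ∃ q : FinDist F, ∀ x ∈ A, b < finExpect q (r x) := by
  classical
  -- If no `q` works, the open orthant `U` misses the convex set `T` of attainable payoff vectors.
  -- The separating functional, normalized, is a mixed strategy on `A` that contradicts `hb`.
  let U : Set (A → ℝ) := {v | ∀ x, b < v x}
  let T : Set (A → ℝ) := {v | ∃ q : FinDist F, ∀ x : A, v x = finExpect q (r x)}
  by_contra! hcon
  have hU : Convex ℝ U := by
    intro v hv w hw s t hs ht hst x
    have h1 := hv x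
    have h2 := hw x
    simp only [Pi.add_apply, Pi.smul_apply, smul_eq_mul]
    have hb' : b = s * b + t * b := by rw [← add_mul, hst, one_mul]
    rcases hs.eq_or_lt with rfl | hs'
    · have : t = 1 := by linarith
      subst this
      linarith
    · nlinarith
  have hUo : IsOpen U := by
    have : U = ⋂ x, {v | b < v x} := by ext; simp [U]
    rw [this]
    exact isOpen_iInter_of_finite fun x => isOpen_lt continuous_const (continuous_apply x)
  have hT : Convex ℝ T := by
    rintro v ⟨q, hq⟩ w ⟨q', hq'⟩ s t hs ht hst
    refine ⟨Convexity.convexCombPair s t hs ht hst q q', fun x => ?_⟩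
    simp [finExpect_convexCombPair, hq, hq']
  have hd : Disjoint U T := by
    rw [Set.disjoint_left]
    rintro v hv ⟨q, hq⟩
    obtain ⟨x, hx, hx'⟩ := hcon q
    have := hv ⟨x, hx⟩
    rw [hq] at this
    exact absurd this (not_lt.2 hx')
  obtain ⟨φ, u, hφU, hφT⟩ := geometric_hahn_banach_open hU hUo hT hd
  have hφ : ∀ v : A → ℝ, φ v = ∑ x, v x * φ (Pi.single x 1) := by
    intro v
    conv_lhs => rw [pi_eq_sum_univ' v]
    simp [map_sum]
  set w : A → ℝ := fun x => - φ (Pi.single x 1) with hw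
  have hφw : ∀ v : A → ℝ, φ v = - ∑ x, w x * v x := by
    intro v
    rw [hφ, ← Finset.sum_neg_distrib]
    exact Finset.sum_congr rfl fun x _ => by simp [hw, mul_comm]
  have hw0 : ∀ x, 0 ≤ w x := by
    intro x
    -- `U` is closed under raising a coordinate, so a negative weight would make `φ` unbounded above
    -- on `U`.
    by_contra! hx
    set M : ℝ := ∑ y, w y * (b + 1)
    obtain ⟨n, hn⟩ := exists_nat_gt ((M + u) / (- w x))
    have hmem : (fun y => b + 1 + (Pi.single x (n : ℝ) : A → ℝ) y) ∈ U := by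
      intro y
      have : (0 : ℝ) ≤ (Pi.single x (n : ℝ) : A → ℝ) y := by
        by_cases h : y = x
        · subst h; simp
        · simp [h]
      linarith
    have h1 := hφU _ hmem
    rw [hφw] at h1
    have h2 : ∑ y, w y * (b + 1 + (Pi.single x (n : ℝ) : A → ℝ) y) = M + w x * n := by
      simp only [mul_add _ (b + 1), Finset.sum_add_distrib, M]
      congr 1
      simp [Pi.single_apply]
    rw [h2] at h1
    rw [div_lt_iff₀ (by linarith)] at hn
    linarith
  set W : ℝ := ∑ x, w x with hW
  obtain ⟨f₀⟩ := ‹Nonempty F›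
  have hsingle : ∀ f, u ≤ - ∑ x : A, w x * r x f := by
    intro f
    rw [← hφw (fun x => r x f)]
    exact hφT _ ⟨Convexity.StdSimplex.single f, fun x => (finExpect_single f _).symm⟩
  have hUc : ∀ η : ℝ, 0 < η → - (W * (b + η)) < u := by
    intro η hη
    have := hφU (fun _ => b + η) (fun x => by simpa using hη)
    rwa [hφw, ← Finset.sum_mul] at this
  have hWpos : 0 < W := by
    refine lt_of_le_of_ne (Finset.sum_nonneg fun x _ => hw0 x) fun h => ?_
    have hz : ∀ x, w x = 0 := fun x =>
      (Finset.sum_eq_zero_iff_of_nonneg fun x _ => hw0 x).1 h.symm x (Finset.mem_univ x)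
    have h1 := hUc 1 one_pos
    have h2 := hsingle f₀
    simp only [hz, zero_mul, Finset.sum_const_zero] at h2
    rw [← h] at h1
    linarith
  let p₀ : FinDist A :=
    { weights := Finsupp.equivFunOnFinite.symm fun x => w x / W
      nonneg := fun x => div_nonneg (hw0 x) hWpos.le
      total := by
        rw [Finsupp.sum_fintype _ _ (by simp)]
        simp only [Finsupp.equivFunOnFinite_symm_apply_apply]
        rw [← Finset.sum_div, div_self hWpos.ne'] }
  obtain ⟨f, hf⟩ := hb (p₀.map Subtype.val)
  have hfe : finExpect (p₀.map Subtype.val) (fun x => r x f) = (∑ x : A, w x * r x f) / W := by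
    rw [finExpect, Convexity.StdSimplex.weights_map,
      Finsupp.sum_mapDomain_index (by simp) (by intros; ring),
      Finsupp.sum_fintype _ _ (by simp), Finset.sum_div]
    exact Finset.sum_congr rfl fun x _ => by
      simp [p₀, div_mul_eq_mul_div]
  rw [hfe, lt_div_iff₀ hWpos] at hf
  set z := ∑ x : A, w x * r x f
  -- The shift is chosen so that the constant vector in `U` has the same `φ`-value `-z` as the
  -- payoff vector of `f` in `T`.
  have h1 := hUc ((z - b * W) / W) (div_pos (by linarith) hWpos)
  have h2 := hsingle f
  have h3 : W * (b + (z - b * W) / W) = z := by field_simp; ring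
  rw [h3] at h1
  linarith

end finExpect

/-! ### Sequential shattering by recursion on depth -/

/-- The complete binary tree with root label `z` and subtrees `l` (on sign `-1`), `r` (on sign
`1`). -/
def BinTree.glue {Z : Type*} {n : ℕ} (z : Z) (l r : BinTree Z n) : BinTree Z (n + 1) := fun t =>
  Fin.cases (motive := fun t : Fin (n + 1) => (Fin (t : ℕ) → ℤˣ) → Z) (fun _ => z)
    (fun t (k : Fin ((t : ℕ) + 1) → ℤˣ) =>
      if k 0 = 1 then r t (fun i => k i.succ) else l t (fun i => k i.succ)) t

lemma BinTree.label_glue_zero {Z : Type*} {n : ℕ} (z : Z) (l r : BinTree Z n)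
    (k : Fin (n + 1) → ℤˣ) : (BinTree.glue z l r).label k 0 = z := rfl

lemma BinTree.label_glue_succ {Z : Type*} {n : ℕ} (z : Z) (l r : BinTree Z n)
    (k : Fin (n + 1) → ℤˣ) (t : Fin n) :
    (BinTree.glue z l r).label k t.succ =
      if k 0 = 1 then r.label (fun i => k i.succ) t else l.label (fun i => k i.succ) t := rfl

/-- `α`-shattering of a tree of depth `n` by a subclass `G ⊆ F`, by recursion on the depth. -/
def RecShatters {X F : Type*} (r : X → F → ℝ) (α : ℝ) : ℕ → Set F → Prop
  | 0, G => G.Nonempty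
  | n + 1, G => ∃ x s, RecShatters r α n {f ∈ G | r x f ≤ s - α / 2} ∧
      RecShatters r α n {f ∈ G | s + α / 2 ≤ r x f}

section RecShatters

variable {X F : Type*} {r : X → F → ℝ} {α : ℝ}

lemma RecShatters.mono {n : ℕ} {G H : Set F} (h : RecShatters r α n G) (hGH : G ⊆ H) :
    RecShatters r α n H := by
  induction n generalizing G H with
  | zero => exact Set.Nonempty.mono hGH h
  | succ n ih =>
    obtain ⟨x, s, h₁, h₂⟩ := h
    exact ⟨x, s, ih h₁ fun f hf => ⟨hGH hf.1, hf.2⟩, ih h₂ fun f hf => ⟨hGH hf.1, hf.2⟩⟩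

lemma RecShatters.nonempty {n : ℕ} {G : Set F} (h : RecShatters r α n G) : G.Nonempty := by
  induction n generalizing G with
  | zero => exact h
  | succ n ih =>
    obtain ⟨x, s, h₁, -⟩ := h
    exact (ih h₁).mono fun f hf => hf.1

lemma RecShatters.exists_binTree {ℓ : X → F → unitInterval} (hα : 0 ≤ α) {n : ℕ} {G : Set F}
    (h : RecShatters (fun x f => (ℓ x f : ℝ)) α n G) :
    ∃ (x : BinTree X n) (s : BinTree unitInterval n), ∀ k : Fin n → ℤˣ, ∃ f ∈ G, ∀ t : Fin n,
      α / 2 ≤ (((k t : ℤˣ) : ℤ) : ℝ) * ((ℓ (x.label k t) f : ℝ) - (s.label k t : ℝ)) := by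
  induction n generalizing G with
  | zero =>
    obtain ⟨f, hf⟩ := h
    exact ⟨fun t => t.elim0, fun t => t.elim0, fun _ => ⟨f, hf, fun t => t.elim0⟩⟩
  | succ n ih =>
    obtain ⟨x, s, h₁, h₂⟩ := h
    -- Thresholds in `RecShatters` are arbitrary reals; nonemptiness of both halves forces them into
    -- `[0, 1]`.
    have hs : s ∈ Set.Icc (0 : ℝ) 1 := by
      obtain ⟨f, -, hf⟩ := h₁.nonempty
      obtain ⟨g, -, hg⟩ := h₂.nonempty
      have h3 := (ℓ x f).2.1
      have h4 := (ℓ x g).2.2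
      simp only at hf hg
      exact ⟨by linarith, by linarith⟩
    obtain ⟨x₁, s₁, H₁⟩ := ih h₁
    obtain ⟨x₂, s₂, H₂⟩ := ih h₂
    refine ⟨BinTree.glue x x₁ x₂, BinTree.glue ⟨s, hs⟩ s₁ s₂, fun k => ?_⟩
    rcases Int.units_eq_one_or (k 0) with hk | hk
    · obtain ⟨f, ⟨hfG, hf⟩, H⟩ := H₂ fun i => k i.succ
      refine ⟨f, hfG, fun t => ?_⟩
      refine Fin.cases ?_ (fun t => ?_) t
      · rw [BinTree.label_glue_zero, BinTree.label_glue_zero, hk]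
        simp only [Units.val_one, Int.cast_one, one_mul]
        linarith
      · rw [BinTree.label_glue_succ, BinTree.label_glue_succ, if_pos hk, if_pos hk]
        exact H t
    · have hk' : k 0 ≠ 1 := by rw [hk]; decide
      obtain ⟨f, ⟨hfG, hf⟩, H⟩ := H₁ fun i => k i.succ
      refine ⟨f, hfG, fun t => ?_⟩
      refine Fin.cases ?_ (fun t => ?_) t
      · rw [BinTree.label_glue_zero, BinTree.label_glue_zero, hk]
        simp only [Units.val_neg, Units.val_one, Int.cast_neg, Int.cast_one, neg_mul, one_mul]
        linarith
      · rw [BinTree.label_glue_succ, BinTree.label_glue_succ, if_neg hk', if_neg hk']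
        exact H t

lemma IsSGCGame.exists_not_recShatters {ℓ : X → F → unitInterval} (hℓ : IsSGCGame ℓ)
    (hα : 0 < α) : ∃ d, ¬ RecShatters (fun x f => (ℓ x f : ℝ)) α d Set.univ := by
  by_contra! hcon
  refine (hℓ α hα).ne (ENat.eq_top_iff_forall_ge.2 fun d => ?_)
  obtain ⟨x, s, H⟩ := (hcon d).exists_binTree hα.le
  refine le_iSup₂_of_le d ⟨x, s, fun k => ?_⟩ le_rfl
  obtain ⟨f, -, hf⟩ := H k
  exact ⟨_, ⟨f, rfl⟩, hf⟩

/-- A class that shatters no tree of depth `d + 1` splits, at each point `x`, into a part of small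
oscillation at `x` and two parts that shatter no tree of depth `d`. -/
lemma exists_split (hr : ∀ x f, r x f ∈ Set.Icc (0 : ℝ) 1) (hα : 0 < α) {d : ℕ} {G : Set F}
    (hG : ¬ RecShatters r α (d + 1) G) (x : X) :
    ∃ v ∈ Set.Icc (0 : ℝ) 1, ¬ RecShatters r α d {f ∈ G | v + 2 * α ≤ r x f} ∧
      ¬ RecShatters r α d {f ∈ G | r x f ≤ v - 2 * α} := by
  by_cases hd : RecShatters r α d G
  swap
  · exact ⟨0, by simp, fun h => hd (h.mono fun f hf => hf.1), fun h => hd (h.mono fun f hf => hf.1)⟩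
  -- The splitting value is the supremum of the levels above which `G` still shatters depth `d`.
  set U : Set ℝ := {s | RecShatters r α d {f ∈ G | s ≤ r x f}} with hU
  have h0 : (0 : ℝ) ∈ U := hd.mono fun f hf => ⟨hf, (hr x f).1⟩
  have h1 : ∀ s ∈ U, s ≤ 1 := by
    intro s hs
    obtain ⟨f, -, hf⟩ := RecShatters.nonempty hs
    exact le_trans hf (hr x f).2
  have hbdd : BddAbove U := ⟨1, h1⟩
  refine ⟨sSup U, ⟨le_csSup hbdd h0, csSup_le ⟨0, h0⟩ h1⟩, fun h => ?_, fun h => ?_⟩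
  · have := le_csSup hbdd (show sSup U + 2 * α ∈ U from h)
    linarith
  · obtain ⟨s, hs, hlt⟩ := exists_lt_of_lt_csSup ⟨0, h0⟩ (show sSup U - α < sSup U by linarith)
    -- Around the threshold `s - α / 2` the halves are `r x f ≤ s - α` and `s ≤ r x f`. The first
    -- contains the low part because `s > sSup U - α`, so `G` would shatter depth `d + 1`.
    refine hG ⟨x, s - α / 2, h.mono fun f hf => ⟨hf.1, ?_⟩, RecShatters.mono hs fun f hf =>
      ⟨hf.1, ?_⟩⟩
    · have := hf.2
      linarith
    · have := hf.2
      linarith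

end RecShatters

/-! ### Signed averages over trees: upper and lower bounds -/

/-- A complete binary tree of depth `n`, with inner nodes labelled by `X` and leaves by `F`. -/
inductive LeafTree (X F : Type*) : ℕ → Type _
  | leaf (f : F) : LeafTree X F 0
  | node {n : ℕ} (x : X) (l r : LeafTree X F n) : LeafTree X F (n + 1)

namespace LeafTree

variable {X F : Type*}

/-- The average over the root-to-leaf paths, with nodes `x₁, …, xₙ`, signs `ε₁, …, εₙ` and leaf
`f`, of `h f + ∑ εₜ r(xₜ, f)`. -/
noncomputable def mean (r : X → F → ℝ) : {n : ℕ} → LeafTree X F n → (F → ℝ) → ℝ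
  | _, leaf f, h => h f
  | _, node x t₁ t₂, h =>
      (mean r t₁ (fun f => h f - r x f) + mean r t₂ (fun f => h f + r x f)) / 2

/-- The average over the root-to-leaf paths, with nodes `x₁, …, xₙ`, signs `ε₁, …, εₙ` and leaf
`f`, of `w f * exp (c ∑ εₜ r(xₜ, f))`. -/
noncomputable def expMean (r : X → F → ℝ) (c : ℝ) : {n : ℕ} → LeafTree X F n → (F → ℝ) → ℝ
  | _, leaf f, w => w f
  | _, node x t₁ t₂, w =>
      (expMean r c t₁ (fun f => w f * Real.exp (-(c * r x f))) +
        expMean r c t₂ (fun f => w f * Real.exp (c * r x f))) / 2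

variable {r : X → F → ℝ} {c : ℝ} {n : ℕ}

/-- Jensen's inequality for the uniform measure on paths, applied one node at a time as AM-GM. -/
lemma exp_mean_le (t : LeafTree X F n) (h : F → ℝ) :
    Real.exp (c * t.mean r h) ≤ t.expMean r c fun f => Real.exp (c * h f) := by
  induction t generalizing h with
  | leaf f => exact le_rfl
  | node x t₁ t₂ ih₁ ih₂ =>
    simp only [mean, expMean, ← Real.exp_add]
    have h₁ := ih₁ fun f => h f - r x f
    have h₂ := ih₂ fun f => h f + r x f
    simp only [mul_add, sub_eq_add_neg, mul_neg] at h₁ h₂ ⊢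
    refine le_trans ?_ (div_le_div_of_nonneg_right (add_le_add h₁ h₂) zero_le_two)
    set a := mean r t₁ fun f => h f + -r x f
    set b := mean r t₂ fun f => h f + r x f
    have e1 := (Real.exp_pos (c * a / 2))
    have e2 : Real.exp (c * a) = Real.exp (c * a / 2) * Real.exp (c * a / 2) := by
      rw [← Real.exp_add]; ring_nf
    have e3 : Real.exp (c * b) = Real.exp (c * b / 2) * Real.exp (c * b / 2) := by
      rw [← Real.exp_add]; ring_nf
    have e4 : Real.exp (c * ((a + b) / 2)) = Real.exp (c * a / 2) * Real.exp (c * b / 2) := by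
      rw [← Real.exp_add]; ring_nf
    rw [e2, e3, e4]
    nlinarith [sq_nonneg (Real.exp (c * a / 2) - Real.exp (c * b / 2))]

lemma expMean_mono (t : LeafTree X F n) {v w : F → ℝ} (h : ∀ f, v f ≤ w f) :
    t.expMean r c v ≤ t.expMean r c w := by
  induction t generalizing v w with
  | leaf f => exact h f
  | node x t₁ t₂ ih₁ ih₂ =>
    exact div_le_div_of_nonneg_right (add_le_add
      (ih₁ fun f => mul_le_mul_of_nonneg_right (h f) (Real.exp_pos _).le)
      (ih₂ fun f => mul_le_mul_of_nonneg_right (h f) (Real.exp_pos _).le)) zero_le_two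

lemma expMean_add (t : LeafTree X F n) (v w : F → ℝ) :
    t.expMean r c (fun f => v f + w f) = t.expMean r c v + t.expMean r c w := by
  induction t generalizing v w with
  | leaf f => rfl
  | node x t₁ t₂ ih₁ ih₂ =>
    simp only [expMean, add_mul, ih₁, ih₂]
    ring

lemma expMean_const_mul (t : LeafTree X F n) (a : ℝ) (w : F → ℝ) :
    t.expMean r c (fun f => a * w f) = a * t.expMean r c w := by
  induction t generalizing w with
  | leaf f => rfl
  | node x t₁ t₂ ih₁ ih₂ =>
    simp only [expMean, mul_assoc, ih₁, ih₂]
    ring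

/-- If `c * r x` is within `δ` of `u` on `G`, then the root `x` contributes at most the factor
`exp δ * cosh u`. -/
lemma expMean_node_indicator_le {x : X} {t₁ t₂ : LeafTree X F n} {G : Set F} {u δ B : ℝ}
    (hG : ∀ f ∈ G, |c * r x f - u| ≤ δ) (h₁ : t₁.expMean r c (G.indicator 1) ≤ B)
    (h₂ : t₂.expMean r c (G.indicator 1) ≤ B) :
    (node x t₁ t₂).expMean r c (G.indicator 1) ≤ Real.exp δ * Real.cosh u * B := by
  have k₁ : t₁.expMean r c (fun f => G.indicator 1 f * Real.exp (-(c * r x f))) ≤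
      Real.exp (δ - u) * B := by
    refine le_trans (expMean_mono t₁ (w := fun f => Real.exp (δ - u) * G.indicator 1 f) ?_) ?_
    · intro f
      by_cases hf : f ∈ G
      · have := abs_le.1 (hG f hf)
        simp only [hf, Set.indicator_of_mem, Pi.one_apply, one_mul, mul_one]
        exact Real.exp_le_exp.2 (by linarith)
      · simp [hf]
    · rw [expMean_const_mul]
      exact mul_le_mul_of_nonneg_left h₁ (Real.exp_pos _).le
  have k₂ : t₂.expMean r c (fun f => G.indicator 1 f * Real.exp (c * r x f)) ≤
      Real.exp (δ + u) * B := by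
    refine le_trans (expMean_mono t₂ (w := fun f => Real.exp (δ + u) * G.indicator 1 f) ?_) ?_
    · intro f
      by_cases hf : f ∈ G
      · have := abs_le.1 (hG f hf)
        simp only [hf, Set.indicator_of_mem, Pi.one_apply, one_mul, mul_one]
        exact Real.exp_le_exp.2 (by linarith)
      · simp [hf]
    · rw [expMean_const_mul]
      exact mul_le_mul_of_nonneg_left h₂ (Real.exp_pos _).le
  simp only [expMean]
  rw [Real.cosh_eq]
  rw [sub_eq_add_neg, Real.exp_add] at k₁
  rw [Real.exp_add] at k₂
  linarith

/-- The sequential Sauer-Shelah lemma, in exponential-moment form: a class that shatters no tree of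
depth `d` has exponential moments growing polynomially, up to the fluctuation and discretization
terms. -/
theorem expMean_indicator_le (hr : ∀ x f, r x f ∈ Set.Icc (0 : ℝ) 1) {α : ℝ} (hα : 0 < α)
    (hc : 0 ≤ c) (t : LeafTree X F n) {d : ℕ} {G : Set F} (hG : ¬ RecShatters r α d G) :
    t.expMean r c (G.indicator 1) ≤
      Real.exp (c * (2 * α) + c ^ 2 / 2) ^ n * (1 + 2 * Real.exp c * n) ^ d := by
  have hempty : ∀ {m : ℕ} (t : LeafTree X F m), t.expMean r c ((∅ : Set F).indicator 1) = 0 := by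
    intro m t
    have := expMean_const_mul (r := r) (c := c) t 0 0
    simpa using this
  induction n generalizing d G with
  | zero =>
    cases t with
    | leaf f =>
      simp only [expMean, pow_zero, Nat.cast_zero, mul_zero, add_zero, one_pow, mul_one]
      exact Set.indicator_le_self' (by simp) f
  | succ n ih =>
    cases t with
    | node x t₁ t₂ =>
    cases d with
    | zero =>
      have : G = ∅ := Set.not_nonempty_iff_eq_empty.1 hG
      rw [this, hempty]
      positivity
    | succ d =>
    obtain ⟨v, hv, hhi, hlo⟩ := exists_split hr hα hG x
    set Ghi : Set F := {f ∈ G | v + 2 * α ≤ r x f}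
    set Glo : Set F := {f ∈ G | r x f ≤ v - 2 * α}
    set Gm : Set F := {f ∈ G | |r x f - v| ≤ 2 * α}
    have hm : ¬ RecShatters r α (d + 1) Gm := fun h => hG (h.mono fun f hf => hf.1)
    set C := Real.exp (c * (2 * α) + c ^ 2 / 2) with hC
    set K := 2 * Real.exp c with hK
    set A := 1 + K * (n : ℝ) with hA
    have hA0 : 0 ≤ A := by positivity
    have hK0 : 0 ≤ K := by positivity
    have hC1 : 1 ≤ C := Real.one_le_exp (by positivity)
    have hone : ∀ f, |c * r x f - 0| ≤ c := fun f => by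
      rw [sub_zero, abs_of_nonneg (mul_nonneg hc (hr x f).1)]
      exact mul_le_of_le_one_right hc (hr x f).2
    -- The outer parts get only the crude factor `exp c` (`u = 0`, `δ = c`), but their dimension has
    -- dropped. Together they contribute `K`.
    have bhi := expMean_node_indicator_le (fun f _ => hone f) (ih t₁ hhi) (ih t₂ hhi)
    have blo := expMean_node_indicator_le (fun f _ => hone f) (ih t₁ hlo) (ih t₂ hlo)
    have bm := expMean_node_indicator_le (u := c * v) (δ := c * (2 * α)) (fun f hf => by
      rw [← mul_sub, abs_mul, abs_of_nonneg hc]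
      exact mul_le_mul_of_nonneg_left hf.2 hc) (ih t₁ hm) (ih t₂ hm)
    rw [Real.cosh_zero, mul_one] at bhi blo
    -- The middle part keeps dimension `d + 1` but is nearly constant at `x`, so it costs one factor
    -- `C`.
    have hcosh : Real.exp (c * (2 * α)) * Real.cosh (c * v) ≤ C := by
      rw [hC, Real.exp_add]
      refine mul_le_mul_of_nonneg_left ((Real.cosh_le_exp_half_sq _).trans
        (Real.exp_le_exp.2 ?_)) (Real.exp_pos _).le
      have : (c * v) ^ 2 ≤ c ^ 2 := by
        refine pow_le_pow_left₀ (mul_nonneg hc hv.1) ?_ 2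
        exact mul_le_of_le_one_right hc hv.2
      linarith
    have hsplit : (node x t₁ t₂).expMean r c (G.indicator 1) ≤
        (node x t₁ t₂).expMean r c (Gm.indicator 1) +
          ((node x t₁ t₂).expMean r c (Ghi.indicator 1) +
            (node x t₁ t₂).expMean r c (Glo.indicator 1)) := by
      rw [← expMean_add, ← expMean_add]
      refine expMean_mono _ fun f => ?_
      have hnn : ∀ S : Set F, 0 ≤ S.indicator (1 : F → ℝ) f := fun S =>
        Set.indicator_nonneg (fun _ _ => zero_le_one) f
      by_cases hf : f ∈ G
      · rw [Set.indicator_of_mem hf, Pi.one_apply]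
        rcases le_total (v + 2 * α) (r x f) with h | h
        · have : Ghi.indicator (1 : F → ℝ) f = 1 :=
            Set.indicator_of_mem (show f ∈ Ghi from ⟨hf, h⟩) _
          linarith [hnn Gm, hnn Glo]
        rcases le_total (r x f) (v - 2 * α) with h' | h'
        · have : Glo.indicator (1 : F → ℝ) f = 1 :=
            Set.indicator_of_mem (show f ∈ Glo from ⟨hf, h'⟩) _
          linarith [hnn Gm, hnn Ghi]
        · have : Gm.indicator (1 : F → ℝ) f = 1 :=
            Set.indicator_of_mem
              (show f ∈ Gm from ⟨hf, abs_le.2 ⟨by linarith, by linarith⟩⟩) _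
          linarith [hnn Glo, hnn Ghi]
      · rw [Set.indicator_of_notMem hf]
        exact add_nonneg (hnn _) (add_nonneg (hnn _) (hnn _))
    have hP : 0 ≤ C ^ n * A ^ (d + 1) := by positivity
    have hQ : 0 ≤ C ^ n * A ^ d := by positivity
    have s1 : (node x t₁ t₂).expMean r c (G.indicator 1) ≤
        C * (C ^ n * A ^ (d + 1)) + K * (C ^ n * A ^ d) := by
      have := mul_le_mul_of_nonneg_right hcosh hP
      rw [hK]
      linarith
    have s2 : K * (C ^ n * A ^ d) ≤ C * (K * (C ^ n * A ^ d)) :=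
      le_mul_of_one_le_left (mul_nonneg hK0 hQ) hC1
    -- Pascal-type step closing the induction: `A + K` is the polynomial base at `n + 1`.
    have s3 : A ^ d * (A + K) ≤ (A + K) ^ (d + 1) := by
      rw [pow_succ]
      exact mul_le_mul_of_nonneg_right (pow_le_pow_left₀ hA0 (by linarith) d) (by linarith)
    have s4 : 1 + K * ((n + 1 : ℕ) : ℝ) = A + K := by push_cast; rw [hA]; ring
    rw [s4]
    calc _ ≤ C * (C ^ n * A ^ (d + 1)) + C * (K * (C ^ n * A ^ d)) := by linarith
      _ = C ^ (n + 1) * (A ^ d * (A + K)) := by ring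
      _ ≤ _ := mul_le_mul_of_nonneg_left s3 (by positivity)

/-- If every mixed strategy of the second player has a reply of loss at most `a`, and every mixed
strategy of the first player has a reply of loss more than `b`, then there are trees of every
depth, of large mean. -/
theorem exists_le_mean [Nonempty F] {a b : ℝ}
    (ha : ∀ q : FinDist F, ∃ x, finExpect q (r x) ≤ a)
    (hb : ∀ p : FinDist X, ∃ f, b < finExpect p fun x => r x f) (n : ℕ) (A : Finset X) :
    ∃ q : FinDist F, (∀ x ∈ A, b < finExpect q (r x)) ∧
      ∀ h : F → ℝ, ∃ t : LeafTree X F n, finExpect q h + n * ((b - a) / 2) ≤ t.mean r h := by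
  classical
  induction n generalizing A with
  | zero =>
    obtain ⟨q, hq⟩ := exists_finDist_forall_lt r b hb A
    refine ⟨q, hq, fun h => ?_⟩
    obtain ⟨f, hf⟩ := exists_finExpect_le q h
    exact ⟨leaf f, by simpa [mean] using hf⟩
  | succ n ih =>
    -- The root `x` is a good reply to `q₁`, used on sign `-1`; `q₂` is then required to lose more
    -- than `b` at `x` as well, and is used on sign `1`. Each level thus gains `(b - a) / 2`.
    -- Carrying an arbitrary finite `A` is what makes this second demand available.
    obtain ⟨q₁, hq₁, H₁⟩ := ih A
    obtain ⟨x, hx⟩ := ha q₁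
    obtain ⟨q₂, hq₂, H₂⟩ := ih (insert x A)
    have hx₂ := hq₂ x (Finset.mem_insert_self x A)
    refine ⟨Convexity.convexCombPair (1 / 2 : ℝ) (1 / 2) (by norm_num) (by norm_num) (by norm_num)
      q₁ q₂, fun y hy => ?_, fun h => ?_⟩
    · rw [finExpect_convexCombPair]
      linarith [hq₁ y hy, hq₂ y (Finset.mem_insert_of_mem hy)]
    · obtain ⟨t₁, ht₁⟩ := H₁ fun f => h f - r x f
      obtain ⟨t₂, ht₂⟩ := H₂ fun f => h f + r x f
      refine ⟨node x t₁ t₂, ?_⟩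
      rw [finExpect_sub] at ht₁
      rw [finExpect_add] at ht₂
      rw [finExpect_convexCombPair]
      simp only [mean]
      push_cast
      linarith

end LeafTree

/-! ### No gap, and the minimax identity -/

/-- In a sequential Glivenko-Cantelli game, there is no gap between the values guaranteed by
finite-support mixed strategies of the two players. -/
theorem IsSGCGame.no_gap {X F : Type*} [Nonempty F] {ℓ : X → F → unitInterval}
    (hℓ : IsSGCGame ℓ) {a b : ℝ} (hab : a < b)
    (ha : ∀ q : FinDist F, ∃ x, finExpect q (fun f => (ℓ x f : ℝ)) ≤ a)
    (hb : ∀ p : FinDist X, ∃ f, b < finExpect p fun x => (ℓ x f : ℝ)) : False := by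
  set η : ℝ := (b - a) / 2 with hη
  have hη0 : 0 < η := by rw [hη]; linarith
  -- With `c = η` and `α = η / 8`, the upper exponent per level is `η ^ 2 / 4 + η ^ 2 / 2`, which
  -- leaves a surplus of `η ^ 2 / 4` below the lower bound `η ^ 2`.
  obtain ⟨d, hd⟩ := hℓ.exists_not_recShatters (α := η / 8) (by positivity)
  set K := 2 * Real.exp η with hK
  have hK0 : 0 < K := by positivity
  have key : ∀ n : ℕ, Real.exp (η ^ 2 / 4) ^ n ≤ (1 + K * n) ^ d := by
    intro n
    obtain ⟨q, -, H⟩ := LeafTree.exists_le_mean (r := fun x f => (ℓ x f : ℝ)) ha hb n ∅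
    obtain ⟨t, ht⟩ := H fun _ => 0
    rw [finExpect_const, zero_add] at ht
    have h₁ := LeafTree.exp_mean_le (r := fun x f => (ℓ x f : ℝ)) (c := η) t fun _ => 0
    have h₂ := LeafTree.expMean_indicator_le (fun x f => (ℓ x f).2)
      (show 0 < η / 8 by positivity) hη0.le t hd
    have h₃ : (Set.univ.indicator 1 : F → ℝ) = fun _ => Real.exp (η * 0) := by
      ext; simp
    rw [h₃] at h₂
    have h₄ : Real.exp (η * (n * η)) ≤ Real.exp (η * t.mean (fun x f => (ℓ x f : ℝ)) fun _ => 0) :=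
      Real.exp_le_exp.2 (mul_le_mul_of_nonneg_left ht hη0.le)
    have h₅ := h₄.trans (h₁.trans h₂)
    have e₁ : η * (n * η) = n * (η * (2 * (η / 8)) + η ^ 2 / 2) + n * (η ^ 2 / 4) := by ring
    rw [e₁, Real.exp_add, Real.exp_nat_mul, Real.exp_nat_mul] at h₅
    exact le_of_mul_le_mul_left h₅ (by positivity)
  have hlim := tendsto_pow_const_mul_const_pow_of_abs_lt_one d
    (r := Real.exp (-(η ^ 2 / 4))) (by
      rw [abs_of_pos (Real.exp_pos _), Real.exp_lt_one_iff]
      have : 0 < η ^ 2 / 4 := by positivity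
      linarith)
  have hpos : (0 : ℝ) < 1 / (1 + K) ^ d := by positivity
  obtain ⟨n, hn, hn1⟩ :=
    ((hlim.eventually (gt_mem_nhds hpos)).and (Filter.eventually_ge_atTop 1)).exists
  rw [Real.exp_neg, inv_pow, ← div_eq_mul_inv, div_lt_div_iff₀ (by positivity) (by positivity),
    one_mul, ← mul_pow] at hn
  have h₁ : (1 : ℝ) ≤ n := by exact_mod_cast hn1
  have h₂ : (1 + K * n) ^ d ≤ (n * (1 + K)) ^ d :=
    pow_le_pow_left₀ (by positivity) (by nlinarith) d
  linarith [key n]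

/-- A two-player game with payoffs in `[0, 1]` and no gap between the guaranteed values satisfies
the minimax identity. -/
lemma iInf_iSup_eq_iSup_iInf_of_no_gap {A B : Type*} [Nonempty A] [Nonempty B] (v : A → B → ℝ)
    (hv : ∀ p q, v p q ∈ Set.Icc (0 : ℝ) 1)
    (h : ∀ a b : ℝ, a < b → (∀ q, ∃ p, v p q < a) → (∀ p, ∃ q, b < v p q) → False) :
    (⨅ p, ⨆ q, v p q) = ⨆ q, ⨅ p, v p q := by
  have bA : ∀ q, BddBelow (Set.range fun p => v p q) := fun q =>
    ⟨0, by rintro _ ⟨p, rfl⟩; exact (hv p q).1⟩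
  have bB : ∀ p, BddAbove (Set.range fun q => v p q) := fun p =>
    ⟨1, by rintro _ ⟨q, rfl⟩; exact (hv p q).2⟩
  have bS : BddBelow (Set.range fun p => ⨆ q, v p q) :=
    ⟨0, by rintro _ ⟨p, rfl⟩; exact Real.iSup_nonneg fun q => (hv p q).1⟩
  have bI : BddAbove (Set.range fun q => ⨅ p, v p q) :=
    ⟨1, by
      rintro _ ⟨q, rfl⟩
      exact (ciInf_le (bA q) (Classical.arbitrary A)).trans (hv _ q).2⟩
  refine le_antisymm ?_ (ciSup_le fun q => le_ciInf fun p =>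
    (ciInf_le (bA q) p).trans (le_ciSup (bB p) q))
  by_contra! hlt
  obtain ⟨a, ha, ha'⟩ := exists_between hlt
  obtain ⟨b, hb, hb'⟩ := exists_between ha'
  exact h a b hb (fun q => exists_lt_of_ciInf_lt ((le_ciSup bI q).trans_lt ha))
    fun p => exists_lt_of_lt_ciSup (hb'.trans_le (ciInf_le bS p))

/-! ### Passage to general probability measures -/

/-- A finite-support distribution as a probability measure. -/
noncomputable def finMeasure {S : Type*} [MeasurableSpace S] (q : FinDist S) :
    ProbabilityMeasure S :=
  ⟨∑ s ∈ q.weights.support, ENNReal.ofReal (q.weights s) • Measure.dirac s, ⟨by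
    simp only [Measure.coe_finsetSum, Finset.sum_apply, Measure.smul_apply, measure_univ,
      smul_eq_mul, mul_one]
    rw [← ENNReal.ofReal_sum_of_nonneg fun s _ => q.nonneg s]
    exact (congrArg ENNReal.ofReal q.total).trans ENNReal.ofReal_one⟩⟩

/-- Singletons need not be measurable, but a set that is null for the point mass cannot contain `s`;
hence `g` agrees at `s` with its measurable representative. -/
lemma integral_dirac_of_aestronglyMeasurable {S : Type*} [MeasurableSpace S] {g : S → ℝ} {s : S}
    (hg : AEStronglyMeasurable g (Measure.dirac s)) : ∫ x, g x ∂(Measure.dirac s) = g s := by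
  have hs : g s = hg.mk g s := by
    by_contra hne
    have h0 : Measure.dirac s {x | ¬ g x = hg.mk g x} = 0 := ae_iff.1 hg.ae_eq_mk
    have h1 := Measure.le_dirac_apply (a := s) (s := {x | ¬ g x = hg.mk g x})
    rw [h0, Set.indicator_of_mem (show s ∈ {x | ¬ g x = hg.mk g x} from hne)] at h1
    simp at h1
  rw [integral_congr_ae hg.ae_eq_mk, integral_dirac' _ _ hg.stronglyMeasurable_mk, hs]

lemma integral_finMeasure {S : Type*} [MeasurableSpace S] (q : FinDist S) {g : S → ℝ}
    (hg : Integrable g (finMeasure q : Measure S)) :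
    ∫ s, g s ∂(finMeasure q : Measure S) = finExpect q g := by
  have hg' : ∀ s ∈ q.weights.support,
      Integrable g (ENNReal.ofReal (q.weights s) • Measure.dirac s) :=
    integrable_finsetSum_measure.1 hg
  change ∫ s, g s ∂(∑ s ∈ q.weights.support, ENNReal.ofReal (q.weights s) • Measure.dirac s) = _
  rw [integral_finsetSum_measure hg', finExpect, Finsupp.sum]
  refine Finset.sum_congr rfl fun s hs => ?_
  have hpos : 0 < q.weights s := lt_of_le_of_ne (q.nonneg s) (Finsupp.mem_support_iff.1 hs).symm
  rw [integral_smul_measure, ENNReal.toReal_ofReal hpos.le, smul_eq_mul,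
    integral_dirac_of_aestronglyMeasurable]
  exact ((integrable_smul_measure (ENNReal.ofReal_pos.2 hpos).ne' ENNReal.ofReal_ne_top).1
    (hg' s hs)).aestronglyMeasurable

section expLoss

variable {X F : Type*} [MeasurableSpace X] [MeasurableSpace F] {ℓ : X → F → unitInterval}

lemma HasExpLoss.integrable (h : HasExpLoss ℓ) (P : ProbabilityMeasure X)
    (Q : ProbabilityMeasure F) :
    Integrable (fun z : X × F => (ℓ z.1 z.2 : ℝ)) ((P : Measure X).prod (Q : Measure F)) :=
  Integrable.of_bound (h P Q).aestronglyMeasurable 1 (Filter.Eventually.of_forall fun z => by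
    rw [Real.norm_of_nonneg (ℓ z.1 z.2).2.1]
    exact (ℓ z.1 z.2).2.2)

lemma HasExpLoss.expLoss_mem (h : HasExpLoss ℓ) (P : ProbabilityMeasure X)
    (Q : ProbabilityMeasure F) : expLoss ℓ P Q ∈ Set.Icc (0 : ℝ) 1 := by
  refine ⟨integral_nonneg fun z => (ℓ z.1 z.2).2.1, ?_⟩
  have := integral_mono (h.integrable P Q) (integrable_const 1) fun z => (ℓ z.1 z.2).2.2
  simpa [expLoss] using this

/-- By Fubini, only pure replies to a finite-support strategy need testing. Sections are integrable
only for almost every `f`, which suffices under the outer integral. -/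
lemma HasExpLoss.expLoss_finMeasure_left_le (h : HasExpLoss ℓ) (p : FinDist X)
    (Q : ProbabilityMeasure F) {b : ℝ} (hb : ∀ f, finExpect p (fun x => (ℓ x f : ℝ)) ≤ b) :
    expLoss ℓ (finMeasure p) Q ≤ b := by
  have hi := h.integrable (finMeasure p) Q
  rw [expLoss, integral_prod_symm _ hi]
  have := integral_mono_ae hi.integral_prod_right (integrable_const b) (by
    filter_upwards [hi.prod_left_ae] with f hf
    exact (integral_finMeasure p hf).trans_le (hb f))
  simpa using this

lemma HasExpLoss.le_expLoss_finMeasure_right (h : HasExpLoss ℓ) (P : ProbabilityMeasure X)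
    (q : FinDist F) {a : ℝ} (ha : ∀ x, a ≤ finExpect q (fun f => (ℓ x f : ℝ))) :
    a ≤ expLoss ℓ P (finMeasure q) := by
  have hi := h.integrable P (finMeasure q)
  rw [expLoss, integral_prod _ hi]
  have := integral_mono_ae (integrable_const a) hi.integral_prod_left (by
    filter_upwards [hi.prod_right_ae] with x hx
    exact (ha x).trans_eq (integral_finMeasure q hx).symm)
  simpa using this

end expLoss

theorem theorem8 {X F : Type*} [Nonempty X] [Nonempty F] (ℓ : X → F → unitInterval)
    (hℓ : IsSGCGame ℓ) :
    (∀ (_ : MeasurableSpace X) (_ : MeasurableSpace F), HasExpLoss ℓ →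
      (⨅ P : ProbabilityMeasure X, ⨆ Q : ProbabilityMeasure F, expLoss ℓ P Q) =
        ⨆ Q : ProbabilityMeasure F, ⨅ P : ProbabilityMeasure X, expLoss ℓ P Q) ∧
    (⨅ p : FinDist X, ⨆ q : FinDist F, finExpLoss ℓ p q) =
      ⨆ q : FinDist F, ⨅ p : FinDist X, finExpLoss ℓ p q := by
  have hX : Nonempty (FinDist X) := ⟨Convexity.StdSimplex.single (Classical.arbitrary X)⟩
  have hF : Nonempty (FinDist F) := ⟨Convexity.StdSimplex.single (Classical.arbitrary F)⟩
  constructor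
  · intro _ _ hm
    have : Nonempty (ProbabilityMeasure X) := hX.map finMeasure
    have : Nonempty (ProbabilityMeasure F) := hF.map finMeasure
    refine iInf_iSup_eq_iSup_iInf_of_no_gap _ hm.expLoss_mem fun a b hab ha hb =>
      hℓ.no_gap hab (fun q => ?_) fun p => ?_
    · by_contra! hcon
      obtain ⟨P, hP⟩ := ha (finMeasure q)
      exact absurd hP (not_lt.2 (hm.le_expLoss_finMeasure_right P q fun x => (hcon x).le))
    · by_contra! hcon
      obtain ⟨Q, hQ⟩ := hb (finMeasure p)
      exact absurd hQ (not_lt.2 (hm.expLoss_finMeasure_left_le p Q hcon))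
  · refine iInf_iSup_eq_iSup_iInf_of_no_gap _ (fun p q => ?_) fun a b hab ha hb =>
      hℓ.no_gap hab (fun q => ?_) fun p => ?_
    · rw [finExpLoss_eq, Set.mem_Icc]
      constructor
      · rw [← finExpect_const p 0]
        refine finExpect_mono p fun x => ?_
        rw [← finExpect_const q 0]
        exact finExpect_mono q fun f => (ℓ x f).2.1
      · rw [← finExpect_const p 1]
        refine finExpect_mono p fun x => ?_
        rw [← finExpect_const q 1]
        exact finExpect_mono q fun f => (ℓ x f).2.2
    · obtain ⟨p, hp⟩ := ha q
      rw [finExpLoss_eq] at hp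
      obtain ⟨x, hx⟩ := exists_le_finExpect p fun x => finExpect q fun f => (ℓ x f : ℝ)
      exact ⟨x, hx.trans hp.le⟩
    · obtain ⟨q, hq⟩ := hb p
      rw [finExpLoss_eq'] at hq
      obtain ⟨f, hf⟩ := exists_finExpect_le q fun f => finExpect p fun x => (ℓ x f : ℝ)
      exact ⟨f, hq.trans_le hf⟩
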